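/- Fix a Grothendieck universe $\mathfrak U$ ("small" means $\mathfrak U$-small; all hom-sets are small). Definitions. A collection $T$ of morphisms of a category $C$ is semi-localizing if it contains all identities, is closed under composition, and for all $f_1\colon Y_1\to X$ in $T$ and $f_2\colon Y_2\to X$ in $C$ there are $g_1\colon Z\to Y_1$ and $g_2\colon Z\to Y_2$ with $g_2\in T$ and $f_1g_1=f_2g_2$. Write $\widehat T$ for the collection of morphisms $f\colon Y\to X$ such that $f\circ g\in T$ for some $g\colon Z\to Y$. A Grothendieck topology $J$ on $C$ is an $A$-topology if there is a semi-localizing $T$ such that the covering sieves are exactly the sieves containing a member of $T$. Let $\mathcal T(J)$ be the collection of morphisms $f\colon Y\to X$ such that the sieve of all morphisms to $X$ factoring through $f$ belongs to $J(X)$. The topology is atomic if every cospan in $C$ can be completed to a commutative square and the covering sieves are exactly the nonempty sieves. A morphism $f\colon Y\to X$ is a Galois covering if there are a group $H$ and a homomorphism $\rho\colon H\to \mathrm{Aut}_X(Y)$ such that for every object $Z$, with $H$ acting on $\mathrm{Hom}(Z,Y)$ through $\rho$ by composition, the map $f\circ -\colon \mathrm{Hom}(Z,Y)\to\mathrm{Hom}(Z,X)$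 is a pseudo $H$-torsor: it is $H$-invariant, $H$ acts freely on $\mathrm{Hom}(Z,Y)$, and the induced map $H\backslash\mathrm{Hom}(Z,Y)\to\mathrm{Hom}(Z,X)$ is injective. A site $(C,J)$ is a $B$-site if every morphism of $C$ is an epimorphism, $J$ is an $A$-topology, and a composite $f\circ g$ lies in $\mathcal T(J)$ if and only if $f$ and $g$ both do. A $Y$-site is a $B$-site $(C,J)$ such that (1) $C$ is essentially small; (2) for any two objects $X_1,X_2$ there are an object $Z$ and morphisms $Z\to X_1$, $Z\to X_2$ both in $\mathcal T(J)$; (3) $\widehat{\mathcal T'}=\widehat{\mathcal T(J)}$, where $\mathcal T'$ is the collection of all Galois coverings in $C$. A locally profinite group is a locally compact Hausdorff topological group whose compact open subgroups form a basis of neighbourhoods of the unit; a profinite group is a compact, Hausdorff, totally disconnected topological group. Theorem. Let $(C,J)$ be a $Y$-site with $C$ nonempty, such that $J$ is the atomic topology and $\mathrm{Hom}_C(X,Y)$ is finite for all objects $X,Y$ of $C$. Then there is a locally profinite group $G$ such that the category $\mathrm{Shv}(C,J)$ of sheaves of small sets is equivalent to the category of small discrete sets with continuous left $G$-action and $G$-equivariant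 maps. If moreover $C$ has a final object, then $G$ is profinite. -/

import Mathlib

open CategoryTheory Topology

universe v u

namespace YSites

section Collections

variable {C : Type u} [Category.{v} C]

/-- A collection `T` of morphisms is semi-localizing if it contains the identities, is closed
under composition, and satisfies the Ore condition relative to `T`. -/
structure IsSemiLocalizing (T : MorphismProperty C) : Prop where
  id_mem : ∀ X : C, T (𝟙 X)
  comp_mem : ∀ {Z Y X : C} (g : Z ⟶ Y) (f : Y ⟶ X), T g → T f → T (g ≫ f)
  ore : ∀ {Y₁ Y₂ X : C} (f₁ : Y₁ ⟶ X) (f₂ : Y₂ ⟶ X), T f₁ →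
    ∃ (Z : C) (g₁ : Z ⟶ Y₁) (g₂ : Z ⟶ Y₂), T g₂ ∧ g₁ ≫ f₁ = g₂ ≫ f₂

/-- The saturation of `T`: the morphisms `f : Y ⟶ X` for which some `g : Z ⟶ Y` makes the
composite `Z ⟶ Y ⟶ X` belong to `T`. -/
def saturation (T : MorphismProperty C) : MorphismProperty C :=
  fun Y _ f => ∃ (Z : C) (g : Z ⟶ Y), T (g ≫ f)

/-- `J` is an `A`-topology if, for some semi-localizing collection `T`, the covering sieves are
exactly the sieves that contain a member of `T`. -/
def IsATopology (J : GrothendieckTopology C) : Prop :=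
  ∃ T : MorphismProperty C, IsSemiLocalizing T ∧
    ∀ (X : C) (R : Sieve X), R ∈ J X ↔ ∃ (Y : C) (f : Y ⟶ X), R f ∧ T f

/-- The collection `T(J)` of the morphisms `f` such that the sieve of all morphisms factoring
through `f` is a covering sieve. -/
def coveringMorphisms (J : GrothendieckTopology C) : MorphismProperty C :=
  fun _ X f => Sieve.generate (Presieve.singleton f) ∈ J X

/-- The wide subcategory of `C` with the morphisms in `T` is `Λ`-connected: any two objects
receive morphisms in `T` from a common object. -/
def IsLambdaConnected (T : MorphismProperty C) : Prop :=
  ∀ X Y : C, ∃ (Z : C) (f : Z ⟶ X) (g : Z ⟶ Y), T f ∧ T g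

end Collections

section Galois

/-- A map `φ : S → S'` on a `G`-set `S` is a pseudo `G`-torsor if it is `G`-invariant, `G` acts
freely on `S`, and the induced map on the set of orbits is injective. -/
structure IsPseudoTorsor (G : Type*) [Group G] {S S' : Type*} [MulAction G S] (φ : S → S') :
    Prop where
  map_smul : ∀ (g : G) (s : S), φ (g • s) = φ s
  free : ∀ (g : G) (s : S), g • s = s → g = 1
  injective : ∀ s t : S, φ s = φ t → MulAction.orbitRel G S s t

variable {C : Type u} [Category.{v} C]

/-- Given a homomorphism `ρ` from `G` to the automorphism group of `Y` over `X`, the group `G`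
acts from the left on `Hom(Z, Y)` by composition with `ρ g`. -/
abbrev homAction {X Y : C} (f : Y ⟶ X) {G : Type v} [Group G] (ρ : G →* Aut (Over.mk f)) (Z : C) :
    MulAction G (Z ⟶ Y) where
  smul g h := h ≫ (ρ g).hom.left
  one_smul h := by
    change h ≫ (ρ 1).hom.left = h
    rw [map_one]
    exact Category.comp_id h
  mul_smul g g' h := by
    change h ≫ (ρ (g * g')).hom.left = (h ≫ (ρ g').hom.left) ≫ (ρ g).hom.left
    rw [map_mul, Category.assoc]
    rfl

/-- `f : Y ⟶ X` is a Galois covering if there are a group `G` and a homomorphism from `G` to the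
automorphism group of `Y` over `X` such that, for every object `Z`, composition with `f` is a
pseudo `G`-torsor `Hom(Z, Y) → Hom(Z, X)`.
(Taking `Z = Y` shows that `G` is isomorphic to the automorphism group of `Y` over `X`, so the
universe of `G` imposes no restriction.) -/
def IsGaloisCovering : MorphismProperty C :=
  fun _ _ f => ∃ (G : Type v) (_ : Group G) (ρ : G →* Aut (Over.mk f)), ∀ Z : C,
    letI := homAction f ρ Z
    IsPseudoTorsor G (fun h : Z ⟶ _ => h ≫ f)

/-- `T` has enough Galois coverings if `T` and the collection of all Galois coverings have the
same saturation. -/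
def HasEnoughGaloisCoverings (T : MorphismProperty C) : Prop :=
  saturation (IsGaloisCovering (C := C)) = saturation T

end Galois

section Sites

variable {C : Type u} [Category.{v} C]

/-- `B`-sites: every morphism is an epimorphism, the topology is an `A`-topology, and a composite
belongs to `T(J)` if and only if both factors do. -/
structure IsBSite (J : GrothendieckTopology C) : Prop where
  epi : ∀ {X Y : C} (f : X ⟶ Y), Epi f
  isATopology : IsATopology J
  comp_mem_iff : ∀ {Z Y X : C} (g : Z ⟶ Y) (f : Y ⟶ X),
    coveringMorphisms J (g ≫ f) ↔ coveringMorphisms J f ∧ coveringMorphisms J g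

/-- `Y`-sites, relative to the universe `Type v` in which the morphism sets lie. -/
structure IsYSite (J : GrothendieckTopology C) : Prop extends IsBSite J where
  essentiallySmall : EssentiallySmall.{v} C
  lambdaConnected : IsLambdaConnected (coveringMorphisms J)
  enoughGalois : HasEnoughGaloisCoverings (coveringMorphisms J)

/-- `J` is the atomic topology: `C` satisfies the right Ore condition (every cospan can be
completed to a commutative square) and the covering sieves are the nonempty sieves. -/
def IsAtomicTopology (J : GrothendieckTopology C) : Prop :=
  ∃ hro : GrothendieckTopology.RightOreCondition C, J = GrothendieckTopology.atomic hro

end Sites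

section Groups

variable (G : Type*) [Group G] [TopologicalSpace G]

/-- A locally profinite group is a locally compact Hausdorff topological group whose compact open
subgroups form a basis of neighbourhoods of the unit. -/
structure IsLocallyProfiniteGroup : Prop where
  isTopologicalGroup : IsTopologicalGroup G
  t2Space : T2Space G
  locallyCompactSpace : LocallyCompactSpace G
  hasBasis : (𝓝 (1 : G)).HasBasis
    (fun K : Subgroup G => IsCompact (K : Set G) ∧ IsOpen (K : Set G)) (fun K => (K : Set G))

/-- A profinite group is a compact, Hausdorff, totally disconnected topological group. -/
structure IsProfiniteGroup : Prop where
  isTopologicalGroup : IsTopologicalGroup G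
  compactSpace : CompactSpace G
  t2Space : T2Space G
  totallyDisconnectedSpace : TotallyDisconnectedSpace G

/-- A set with a left `G`-action (and no topology) is a continuous discrete `G`-set if the action
map `G × S → S` is continuous when `S` carries the discrete topology. -/
def IsContinuousDiscrete : ObjectProperty (Action (Type v) G) :=
  fun S =>
    letI : TopologicalSpace S.V := ⊥
    Continuous (fun p : G × S.V => S.ρ p.1 p.2)

/-- The category of discrete sets with continuous left `G`-action and `G`-equivariant maps. -/
abbrev DiscreteGSet : Type _ := (IsContinuousDiscrete.{v} G).FullSubcategory

end Groups

end YSites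

/-! ### Epimorphic Ore categories and towers of Galois coverings. -/

namespace YSites

open Opposite Filter

/-! The argument is Grothendieck's Galois theory with a pro-object as base point. The coverings of a
fixed `X₀` with transitive fibres form a directed system, and finiteness of the Hom-sets allows
coherent transition maps (`exists_galoisTower`). Stalks are colimits along this tower; points of
`X`, the stalk of `yoneda.obj X`, are morphisms from the pro-object to `X`. `Deck` is the opposite
of the endomorphism monoid of the pro-object. Compactness makes it transitive on points
(`exists_smul_eq`), finiteness of fibres over `X₀` makes it a group (`smul_surjective`), and the
stabilizer of the base point is compact (`isCompact_smul_base`).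

In the atomic topology every morphism covers, so restrictions are injective and sections over `X`
are the stalk elements fixed by the stabilizer of a point of `X` (`exists_pull_eq`). Hence the stalk
functor is fully faithful. A continuous set `S` is the stalk of the sheaf of equivariant maps from
points to `S`, which gives essential surjectivity. -/

/-- Every morphism is an epimorphism, every cospan completes to a commutative square, and any two
objects receive morphisms from a common object. -/
class IsEpiOre (C : Type u) [Category.{v} C] : Prop where
  epi : ∀ {X Y : C} (f : X ⟶ Y), Epi f
  ore : ∀ {Y₁ Y₂ X : C} (f₁ : Y₁ ⟶ X) (f₂ : Y₂ ⟶ X),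
    ∃ (Z : C) (g₁ : Z ⟶ Y₁) (g₂ : Z ⟶ Y₂), g₁ ≫ f₁ = g₂ ≫ f₂
  span : ∀ X Y : C, ∃ Z : C, Nonempty (Z ⟶ X) ∧ Nonempty (Z ⟶ Y)

attribute [instance] IsEpiOre.epi

/-- A coherent directed system of Galois coverings of `X₀` through which every morphism to one of
its members can be dominated. -/
structure GaloisTower {C : Type u} [Category.{v} C] (X₀ : C) where
  Index : Type v
  [preorder : Preorder Index]
  [directed : IsDirectedOrder Index]
  [nonempty : Nonempty Index]
  obj : Index → C
  map : ∀ {d e : Index}, d ≤ e → (obj e ⟶ obj d)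
  map_refl : ∀ d : Index, map (le_refl d) = 𝟙 (obj d)
  map_comp : ∀ {c d e : Index} (h : c ≤ d) (h' : d ≤ e), map h' ≫ map h = map (h.trans h')
  str : ∀ d : Index, obj d ⟶ X₀
  map_str : ∀ {d e : Index} (h : d ≤ e), map h ≫ str d = str e
  galois : ∀ (d : Index) {Z : C} (a b : Z ⟶ obj d), a ≫ str d = b ≫ str d →
    ∃ σ : obj d ⟶ obj d, a ≫ σ = b
  lift : ∀ (d : Index) {Z : C} (f : Z ⟶ obj d), ∃ (e : Index) (h : d ≤ e) (g : obj e ⟶ Z),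
    g ≫ f = map h

namespace GaloisTower

attribute [instance] preorder directed nonempty

variable {C : Type u} [Category.{v} C] {X₀ : C} (T : GaloisTower X₀)

/-! ### Stalks along the tower. -/

section Stalk

variable (F : Cᵒᵖ ⥤ Type v)

/-- Two sections over members of the tower have the same germ if they agree further up. -/
def germSetoid : Setoid (Σ d : T.Index, F.obj (op (T.obj d))) where
  r s t := ∃ (c : T.Index) (h : s.1 ≤ c) (h' : t.1 ≤ c),
    F.map (T.map h).op s.2 = F.map (T.map h').op t.2
  iseqv :=
    { refl := fun s => ⟨s.1, le_rfl, le_rfl, rfl⟩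
      symm := fun ⟨c, h, h', e⟩ => ⟨c, h', h, e.symm⟩
      trans := by
        rintro ⟨d, s⟩ ⟨d', s'⟩ ⟨d'', s''⟩ ⟨c, h, h', e⟩ ⟨c', k, k', e'⟩
        obtain ⟨b, hb, hb'⟩ := exists_ge_ge c c'
        refine ⟨b, h.trans hb, k'.trans hb', ?_⟩
        have h₁ := congrArg (F.map (T.map hb).op) e
        have h₂ := congrArg (F.map (T.map hb').op) e'
        simp only [← Functor.map_comp_apply, ← op_comp, T.map_comp] at h₁ h₂ ⊢
        exact h₁.trans h₂ }

/-- The stalk of a presheaf along the tower. -/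
def Stalk : Type v := Quotient (T.germSetoid F)

variable {F}

/-- The germ of a section over a member of the tower. -/
def germ (d : T.Index) (s : F.obj (op (T.obj d))) : T.Stalk F :=
  Quotient.mk (T.germSetoid F) ⟨d, s⟩

theorem germ_map {d e : T.Index} (h : d ≤ e) (s : F.obj (op (T.obj d))) :
    T.germ e (F.map (T.map h).op s) = T.germ d s :=
  Quotient.sound (s := T.germSetoid F) ⟨e, le_rfl, h, by
    simp only [← Functor.map_comp_apply, ← op_comp, T.map_comp]⟩

theorem exists_germ (t : T.Stalk F) : ∃ (d : T.Index) (s : F.obj (op (T.obj d))),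
    T.germ d s = t := by
  obtain ⟨⟨d, s⟩, rfl⟩ := Quotient.exists_rep t
  exact ⟨d, s, rfl⟩

theorem exists_germ_ge (c : T.Index) (t : T.Stalk F) :
    ∃ (d : T.Index) (_ : c ≤ d) (s : F.obj (op (T.obj d))), T.germ d s = t := by
  obtain ⟨d, s, rfl⟩ := T.exists_germ t
  obtain ⟨e, h, h'⟩ := exists_ge_ge c d
  exact ⟨e, h, _, T.germ_map h' s⟩

theorem germ_eq_germ_iff (hF : ∀ {X Y : C} (f : X ⟶ Y), Function.Injective (F.map f.op))
    {d : T.Index} {s t : F.obj (op (T.obj d))} : T.germ d s = T.germ d t ↔ s = t := by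
  refine ⟨fun h => ?_, fun h => h ▸ rfl⟩
  obtain ⟨c, _, _, e⟩ := Quotient.exact (s := T.germSetoid F) h
  exact hF _ e

/-- The map induced on stalks by a morphism of presheaves. -/
def stalkMap {F' : Cᵒᵖ ⥤ Type v} (α : F ⟶ F') : T.Stalk F → T.Stalk F' :=
  Quotient.lift (s := T.germSetoid F) (fun s => T.germ s.1 (α.app _ s.2)) (by
    rintro ⟨d, s⟩ ⟨e, t⟩ ⟨c, h, h', w⟩
    change T.germ d _ = T.germ e _
    rw [← T.germ_map h, ← T.germ_map h', ← NatTrans.naturality_apply,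
      ← NatTrans.naturality_apply]
    exact congrArg _ (congrArg _ w))

@[simp]
theorem stalkMap_germ {F' : Cᵒᵖ ⥤ Type v} (α : F ⟶ F') (d : T.Index)
    (s : F.obj (op (T.obj d))) : T.stalkMap α (T.germ d s) = T.germ d (α.app _ s) := rfl

end Stalk

/-! ### Points of objects, as stalks of representables. -/

section Point

/-- The points of an object along the tower. -/
abbrev Point (X : C) : Type v := T.Stalk (yoneda.obj X)

variable {X Y : C}

/-- The point represented by a morphism from a member of the tower. -/
def pt {d : T.Index} (a : T.obj d ⟶ X) : T.Point X := T.germ (F := yoneda.obj X) d a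

theorem pt_map {d e : T.Index} (h : d ≤ e) (a : T.obj d ⟶ X) : T.pt (T.map h ≫ a) = T.pt a :=
  T.germ_map (F := yoneda.obj X) h a

theorem exists_pt (x : T.Point X) : ∃ (d : T.Index) (a : T.obj d ⟶ X), T.pt a = x :=
  T.exists_germ x

theorem exists_pt_ge (c : T.Index) (x : T.Point X) :
    ∃ (d : T.Index) (_ : c ≤ d) (a : T.obj d ⟶ X), T.pt a = x :=
  T.exists_germ_ge c x

theorem exists_pt_pt (x : T.Point X) (y : T.Point Y) :
    ∃ (d : T.Index) (a : T.obj d ⟶ X) (b : T.obj d ⟶ Y), T.pt a = x ∧ T.pt b = y := by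
  obtain ⟨d, a, rfl⟩ := T.exists_pt x
  obtain ⟨e, h, b, rfl⟩ := T.exists_pt_ge d y
  exact ⟨e, T.map h ≫ a, b, T.pt_map h a, rfl⟩

theorem pt_eq_pt_iff [IsEpiOre C] {d : T.Index} {a b : T.obj d ⟶ X} :
    T.pt a = T.pt b ↔ a = b :=
  T.germ_eq_germ_iff (F := yoneda.obj X) fun f _ _ h => (cancel_epi f).1 h

/-- The functoriality of points. -/
def along (f : X ⟶ Y) : T.Point X → T.Point Y := T.stalkMap (yoneda.map f)

@[simp]
theorem along_pt (f : X ⟶ Y) {d : T.Index} (a : T.obj d ⟶ X) :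
    T.along f (T.pt a) = T.pt (a ≫ f) := rfl

theorem along_along {Z : C} (f : X ⟶ Y) (g : Y ⟶ Z) (x : T.Point X) :
    T.along g (T.along f x) = T.along (f ≫ g) x := by
  obtain ⟨d, a, rfl⟩ := T.exists_pt x
  simp

/-- The tautological point of a member of the tower. -/
def gen (d : T.Index) : T.Point (T.obj d) := T.pt (𝟙 _)

@[simp]
theorem along_gen {d : T.Index} (a : T.obj d ⟶ X) : T.along a (T.gen d) = T.pt a := by
  simp [gen]

theorem along_map_gen {d e : T.Index} (h : d ≤ e) : T.along (T.map h) (T.gen e) = T.gen d := by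
  rw [along_gen, gen, ← T.pt_map h, Category.comp_id]

variable {F : Cᵒᵖ ⥤ Type v}

/-- The germ at a point of `X` of a section over `X`. -/
def pull (x : T.Point X) (s : F.obj (op X)) : T.Stalk F := T.stalkMap (yonedaEquiv.symm s) x

@[simp]
theorem pull_pt {d : T.Index} (a : T.obj d ⟶ X) (s : F.obj (op X)) :
    T.pull (T.pt a) s = T.germ d (F.map a.op s) := rfl

@[simp]
theorem pull_gen (d : T.Index) (s : F.obj (op (T.obj d))) : T.pull (T.gen d) s = T.germ d s := by
  simp [gen]

theorem pull_along (f : X ⟶ Y) (x : T.Point X) (s : F.obj (op Y)) :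
    T.pull (T.along f x) s = T.pull x (F.map f.op s) := by
  obtain ⟨d, a, rfl⟩ := T.exists_pt x
  simp

theorem along_eq_pull (f : X ⟶ Y) (x : T.Point X) :
    T.along f x = T.pull (F := yoneda.obj Y) x f := by
  obtain ⟨d, a, rfl⟩ := T.exists_pt x
  rfl

theorem stalkMap_pull {F' : Cᵒᵖ ⥤ Type v} (α : F ⟶ F') (x : T.Point X) (s : F.obj (op X)) :
    T.stalkMap α (T.pull x s) = T.pull x (α.app _ s) := by
  obtain ⟨d, a, rfl⟩ := T.exists_pt x
  simp [NatTrans.naturality_apply]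

theorem pull_injective (hF : ∀ {X Y : C} (f : X ⟶ Y), Function.Injective (F.map f.op))
    (x : T.Point X) : Function.Injective (T.pull (F := F) x) := by
  obtain ⟨d, a, rfl⟩ := T.exists_pt x
  intro s t h
  exact hF a ((T.germ_eq_germ_iff hF).1 h)

variable [IsEpiOre C]

/-- An Ore square lifts a representative after a base change, and `lift` dominates that base change
by a transition map, which does not alter the point. -/
theorem along_surjective (f : X ⟶ Y) : Function.Surjective (T.along f) := by
  intro y
  obtain ⟨d, a, rfl⟩ := T.exists_pt y
  obtain ⟨W, p, q, w⟩ := IsEpiOre.ore a f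
  obtain ⟨e, h, g, hg⟩ := T.lift d p
  refine ⟨T.pt (g ≫ q), ?_⟩
  rw [along_pt, Category.assoc, ← w, reassoc_of% hg, T.pt_map]

instance (X : C) : Nonempty (T.Point X) := by
  obtain ⟨d⟩ := T.nonempty
  obtain ⟨Z, ⟨p⟩, ⟨q⟩⟩ := IsEpiOre.span (T.obj d) X
  obtain ⟨e, h, g, hg⟩ := T.lift d p
  exact ⟨T.pt (g ≫ q)⟩

end Point

/-! ### The deck monoid and its action on stalks. -/

/-- The coherent families of points of the members of the tower. -/
@[ext]
structure Deck where
  val : ∀ d : T.Index, T.Point (T.obj d)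
  compat : ∀ {d e : T.Index} (h : d ≤ e), T.along (T.map h) (val e) = val d

variable {T}

namespace Deck

instance (F : Cᵒᵖ ⥤ Type v) : SMul T.Deck (T.Stalk F) where
  smul g := Quotient.lift (s := T.germSetoid F) (fun s => T.pull (g.val s.1) s.2) (by
    rintro ⟨d, s⟩ ⟨e, t⟩ ⟨c, h, h', w⟩
    change T.pull _ s = T.pull _ t
    rw [← g.compat h, ← g.compat h', T.pull_along, T.pull_along]
    exact congrArg _ w)

variable {F F' : Cᵒᵖ ⥤ Type v} {X Y : C}

theorem smul_germ (g : T.Deck) (d : T.Index) (s : F.obj (op (T.obj d))) :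
    g • T.germ d s = T.pull (g.val d) s := rfl

theorem smul_pt (g : T.Deck) {d : T.Index} (a : T.obj d ⟶ X) :
    g • T.pt a = T.along a (g.val d) :=
  (T.along_eq_pull a (g.val d)).symm

theorem smul_pull (g : T.Deck) (x : T.Point X) (s : F.obj (op X)) :
    g • T.pull x s = T.pull (g • x) s := by
  obtain ⟨d, a, rfl⟩ := T.exists_pt x
  rw [T.pull_pt, smul_germ, smul_pt, T.pull_along]

theorem smul_along (g : T.Deck) (f : X ⟶ Y) (x : T.Point X) :
    g • T.along f x = T.along f (g • x) := by
  rw [along_eq_pull, along_eq_pull, smul_pull]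

theorem smul_stalkMap (g : T.Deck) (α : F ⟶ F') (t : T.Stalk F) :
    g • T.stalkMap α t = T.stalkMap α (g • t) := by
  obtain ⟨d, s, rfl⟩ := T.exists_germ t
  rw [T.stalkMap_germ, smul_germ, smul_germ, T.stalkMap_pull]

theorem smul_gen (g : T.Deck) (d : T.Index) : g • T.gen d = g.val d := by
  obtain ⟨e, a, h⟩ := T.exists_pt (g.val d)
  rw [gen, smul_pt, ← h, T.along_pt, Category.comp_id]

instance : One T.Deck where
  one := ⟨T.gen, T.along_map_gen⟩

/-- This is composition of pro-object endomorphisms in reverse order, so that precomposition becomes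
a left action. -/
instance : Mul T.Deck where
  mul g g' := ⟨fun d => g • g'.val d, fun h => by rw [← smul_along, g'.compat h]⟩

theorem one_val (d : T.Index) : (1 : T.Deck).val d = T.gen d := rfl

theorem mul_val (g g' : T.Deck) (d : T.Index) : (g * g').val d = g • g'.val d := rfl

theorem one_smul' (t : T.Stalk F) : (1 : T.Deck) • t = t := by
  obtain ⟨d, s, rfl⟩ := T.exists_germ t
  rw [smul_germ, one_val, T.pull_gen]

theorem mul_smul' (g g' : T.Deck) (t : T.Stalk F) : (g * g') • t = g • g' • t := by
  obtain ⟨d, s, rfl⟩ := T.exists_germ t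
  rw [smul_germ, smul_germ, mul_val, smul_pull]

theorem smul_injective [IsEpiOre C] (g : T.Deck) :
    Function.Injective (fun x : T.Point X => g • x) := by
  intro x y h
  obtain ⟨d, a, b, rfl, rfl⟩ := T.exists_pt_pt x y
  obtain ⟨e, w, hw⟩ := T.exists_pt (g.val d)
  simp only [smul_pt, ← hw, T.along_pt, T.pt_eq_pt_iff, cancel_epi] at h
  rw [h]

section Base

variable (T) in
/-- The tautological point of the base. -/
noncomputable def _root_.YSites.GaloisTower.base : T.Point X₀ :=
  T.pt (T.str (Classical.arbitrary T.Index))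

theorem pt_str (d : T.Index) : T.pt (T.str d) = T.base := by
  obtain ⟨e, h, h'⟩ := exists_ge_ge d (Classical.arbitrary T.Index)
  rw [base, ← T.pt_map h, ← T.pt_map h', T.map_str, T.map_str]

end Base

/-! ### Transitivity on points and existence of inverses. -/

section Homogeneity

variable [IsEpiOre C] [∀ X Y : C, Finite (X ⟶ Y)]

variable (T) in
theorem _root_.YSites.GaloisTower.finite_fibre (d : T.Index) (x : T.Point X₀) :
    {y : T.Point (T.obj d) | T.along (T.str d) y = x}.Finite := by
  rcases Set.eq_empty_or_nonempty {y : T.Point (T.obj d) | T.along (T.str d) y = x} with h | ⟨y, hy⟩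
  · rw [h]; exact Set.finite_empty
  · refine (Set.finite_range fun σ : T.obj d ⟶ T.obj d => T.along σ y).subset fun z hz => ?_
    have hyz : T.along (T.str d) y = T.along (T.str d) z := Eq.trans hy (Eq.symm hz)
    obtain ⟨e, a, b, rfl, rfl⟩ := T.exists_pt_pt y z
    rw [T.along_pt, T.along_pt, T.pt_eq_pt_iff] at hyz
    obtain ⟨σ, rfl⟩ := T.galois d a b hyz
    exact ⟨σ, rfl⟩

/-- An inverse limit of nonempty finite sets is nonempty: lifts `q e` of `w` to all later stages are
pushed down to each `d`, where they lie in a finite fibre, and an ultrafilter containing all tails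
selects one value. -/
theorem exists_val_eq (c : T.Index) (w : T.Point (T.obj c)) : ∃ g : T.Deck, g.val c = w := by
  have hq : ∀ e, ∃ q : T.Point (T.obj e), ∀ h : c ≤ e, T.along (T.map h) q = w := fun e => by
    by_cases h : c ≤ e
    · obtain ⟨q, hq⟩ := T.along_surjective (T.map h) w
      exact ⟨q, fun _ => hq⟩
    · exact ⟨Classical.arbitrary _, fun h' => absurd h' h⟩
  choose q hq using hq
  let U : Ultrafilter T.Index := Ultrafilter.of atTop
  have hU : ∀ d : T.Index, ∀ᶠ e in (U : Filter T.Index), d ≤ e := fun d =>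
    (Ultrafilter.of_le atTop) (eventually_ge_atTop d)
  have key : ∀ d, ∃ y ∈ {y : T.Point (T.obj d) | T.along (T.str d) y = T.along (T.str c) w},
      ∀ᶠ e in (U : Filter T.Index), ∃ h : d ≤ e, T.along (T.map h) (q e) = y := fun d => by
    rw [← Ultrafilter.eventually_exists_mem_iff (T.finite_fibre d _)]
    filter_upwards [hU c, hU d] with e hc hd
    refine ⟨_, ?_, hd, rfl⟩
    rw [← hq e hc, T.along_along, T.along_along, T.map_str, T.map_str]
  choose y _ hy using key
  refine ⟨⟨y, fun {d e} h => ?_⟩, ?_⟩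
  · obtain ⟨b, ⟨h₁, e₁⟩, ⟨h₂, e₂⟩⟩ := ((hy d).and (hy e)).exists
    rw [← e₁, ← e₂, T.along_along, T.map_comp]
  · obtain ⟨b, h₁, ⟨h₂, e₂⟩⟩ := ((hU c).and (hy c)).exists
    rw [← hq b h₁]
    exact e₂.symm

theorem exists_smul_eq (x y : T.Point X) : ∃ g : T.Deck, g • x = y := by
  obtain ⟨d, a, rfl⟩ := T.exists_pt x
  obtain ⟨w, rfl⟩ := T.along_surjective a y
  obtain ⟨g, rfl⟩ := exists_val_eq d w
  exact ⟨g, smul_pt g a⟩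

/-- The fibre over the base point at stage `d` is finite and `g`-stable, so the injective action of
`g` permutes it and reaches `T.gen d`, from which every `T.pt a` is obtained by functoriality. -/
theorem smul_surjective_of_smul_base (g : T.Deck) (hg : g • T.base = T.base) :
    Function.Surjective (fun y : T.Point X => g • y) := by
  intro y
  obtain ⟨d, a, rfl⟩ := T.exists_pt y
  have hmaps : Set.MapsTo (fun z : T.Point (T.obj d) => g • z)
      {z | T.along (T.str d) z = T.base} {z | T.along (T.str d) z = T.base} := fun z hz => by
    change T.along (T.str d) (g • z) = T.base
    rw [← smul_along, show T.along (T.str d) z = T.base from hz, hg]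
  obtain ⟨z, _, hz⟩ := (((T.finite_fibre d T.base).injOn_iff_bijOn_of_mapsTo hmaps).1
    g.smul_injective.injOn).surjOn
    (show T.along (T.str d) (T.gen d) = T.base by rw [T.along_gen, pt_str])
  refine ⟨T.along a z, ?_⟩
  change g • T.along a z = _
  rw [smul_along, show g • z = T.gen d from hz, T.along_gen]

theorem smul_surjective (g : T.Deck) : Function.Surjective (fun y : T.Point X => g • y) := by
  intro y
  -- Transitivity supplies `k` carrying the moved base point back, so the previous case applies to
  -- `k * g`.
  obtain ⟨k, hk⟩ := exists_smul_eq (g • T.base) T.base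
  obtain ⟨w, hw⟩ := smul_surjective_of_smul_base (k * g) (by rw [mul_smul', hk]) (k • y)
  exact ⟨w, k.smul_injective ((mul_smul' k g w).symm.trans hw)⟩

theorem exists_mul_eq_one (g : T.Deck) : ∃ k : T.Deck, g * k = 1 := by
  choose w hw using fun d => g.smul_surjective (T.gen d)
  refine ⟨⟨w, fun {d e} h => g.smul_injective ?_⟩, Deck.ext (funext hw)⟩
  change g • _ = g • _
  rw [smul_along, show g • w e = _ from hw e, show g • w d = _ from hw d, T.along_map_gen]

noncomputable instance : Inv T.Deck := ⟨fun g => g.exists_mul_eq_one.choose⟩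

noncomputable instance : Group T.Deck :=
  Group.ofRightAxioms
    (fun g g' g'' => Deck.ext (funext fun d => mul_smul' g g' (g''.val d)))
    (fun g => Deck.ext (funext fun d => g.smul_gen d))
    (fun g => g.exists_mul_eq_one.choose_spec)

noncomputable instance (F : Cᵒᵖ ⥤ Type v) : MulAction T.Deck (T.Stalk F) where
  one_smul := one_smul'
  mul_smul := mul_smul'

end Homogeneity

/-! ### The topology of the deck group. -/

section Topological

instance : TopologicalSpace T.Deck :=
  letI : ∀ d : T.Index, TopologicalSpace (T.Point (T.obj d)) := fun _ => ⊥
  TopologicalSpace.induced val inferInstance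

variable (T) in
theorem isInducing_val :
    letI : ∀ d : T.Index, TopologicalSpace (T.Point (T.obj d)) := fun _ => ⊥
    IsInducing (val (T := T)) :=
  letI : ∀ d : T.Index, TopologicalSpace (T.Point (T.obj d)) := fun _ => ⊥
  ⟨rfl⟩

theorem continuous_val (d : T.Index) :
    letI : TopologicalSpace (T.Point (T.obj d)) := ⊥
    Continuous (fun g : T.Deck => g.val d) :=
  letI : ∀ d : T.Index, TopologicalSpace (T.Point (T.obj d)) := fun _ => ⊥
  (continuous_apply d).comp (isInducing_val T).continuous

theorem isClopen_val_eq (d : T.Index) (y : T.Point (T.obj d)) :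
    IsClopen {g : T.Deck | g.val d = y} :=
  letI : TopologicalSpace (T.Point (T.obj d)) := ⊥
  haveI : DiscreteTopology (T.Point (T.obj d)) := ⟨rfl⟩
  (isClopen_discrete {y}).preimage (continuous_val d)

/-- The families sharing a member with `g` are a neighbourhood basis of `g`. -/
theorem nhds_hasBasis (g : T.Deck) :
    (𝓝 g).HasBasis (fun _ : T.Index => True) (fun d => {k : T.Deck | k.val d = g.val d}) := by
  let _ : ∀ d : T.Index, TopologicalSpace (T.Point (T.obj d)) := fun _ => ⊥
  have _ : ∀ d : T.Index, DiscreteTopology (T.Point (T.obj d)) := fun _ => ⟨rfl⟩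
  refine ⟨fun s => ⟨fun hs => ?_, ?_⟩⟩
  · rw [(isInducing_val T).nhds_eq_comap, mem_comap] at hs
    obtain ⟨t, ht, hts⟩ := hs
    rw [nhds_pi, Filter.mem_pi] at ht
    obtain ⟨I, hI, u, hu, hut⟩ := ht
    -- By coherence, the coordinate at an upper bound of `I` determines all coordinates in `I`.
    obtain ⟨c, hc⟩ := hI.toFinset.exists_le
    refine ⟨c, trivial, fun k hk => hts (hut fun d hd => ?_)⟩
    have hdc := hc d (hI.mem_toFinset.2 hd)
    rw [← k.compat hdc, show k.val c = _ from hk, g.compat hdc]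
    exact mem_of_mem_nhds (hu d)
  · rintro ⟨d, -, hd⟩
    exact mem_of_superset ((isClopen_val_eq d (g.val d)).isOpen.mem_nhds rfl) hd

instance : T2Space T.Deck := by
  let _ : ∀ d : T.Index, TopologicalSpace (T.Point (T.obj d)) := fun _ => ⊥
  have _ : ∀ d : T.Index, DiscreteTopology (T.Point (T.obj d)) := fun _ => ⟨rfl⟩
  exact T2Space.of_injective_continuous (fun _ _ => Deck.ext) (isInducing_val T).continuous

instance : TotallyDisconnectedSpace T.Deck := by
  let _ : ∀ d : T.Index, TopologicalSpace (T.Point (T.obj d)) := fun _ => ⊥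
  have _ : ∀ d : T.Index, DiscreteTopology (T.Point (T.obj d)) := fun _ => ⟨rfl⟩
  have hemb : IsEmbedding (val (T := T)) := ⟨isInducing_val T, fun _ _ => Deck.ext⟩
  exact hemb.isTotallyDisconnected_range.1 (isTotallyDisconnected_of_totallyDisconnectedSpace _)

theorem eventually_smul_eq {F : Cᵒᵖ ⥤ Type v} (g : T.Deck) (t : T.Stalk F) :
    ∀ᶠ k in 𝓝 g, k • t = g • t := by
  obtain ⟨d, s, rfl⟩ := T.exists_germ t
  filter_upwards [(nhds_hasBasis g).mem_of_mem (i := d) trivial] with k hk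
  rw [smul_germ, smul_germ, show k.val d = _ from hk]

variable [IsEpiOre C] [∀ X Y : C, Finite (X ⟶ Y)]

instance : IsTopologicalGroup T.Deck where
  continuous_mul := by
    rw [continuous_iff_continuousAt]
    rintro ⟨g, k⟩
    refine (nhds_hasBasis (g * k)).tendsto_right_iff.2 fun d _ => ?_
    rw [nhds_prod_eq]
    filter_upwards [(eventually_smul_eq g (k.val d)).prod_mk
      ((nhds_hasBasis k).mem_of_mem (i := d) trivial)] with p hp
    change p.1 • p.2.val d = g • k.val d
    rw [show p.2.val d = _ from hp.2, hp.1]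
  continuous_inv := by
    rw [continuous_iff_continuousAt]
    intro g
    refine (nhds_hasBasis g⁻¹).tendsto_right_iff.2 fun d _ => ?_
    filter_upwards [eventually_smul_eq g (g⁻¹.val d)] with k hk
    rw [← smul_gen k⁻¹ d, inv_smul_eq_iff, hk, ← smul_gen g⁻¹, smul_inv_smul]

/-- The stabilizer of the base point is compact. -/
theorem isCompact_smul_base : IsCompact {g : T.Deck | g • T.base = T.base} := by
  let _ : ∀ d : T.Index, TopologicalSpace (T.Point (T.obj d)) := fun _ => ⊥
  have _ : ∀ d : T.Index, DiscreteTopology (T.Point (T.obj d)) := fun _ => ⟨rfl⟩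
  rw [(isInducing_val T).isCompact_iff]
  -- The image in the product of discrete spaces is a product of finite fibres cut by the closed
  -- coherence conditions.
  have hprod : IsCompact (Set.univ.pi fun d : T.Index =>
      {y : T.Point (T.obj d) | T.along (T.str d) y = T.base}) :=
    isCompact_univ_pi fun d => (T.finite_fibre d T.base).isCompact
  have hclosed : IsClosed {y : ∀ d : T.Index, T.Point (T.obj d) |
      ∀ (d e : T.Index) (h : d ≤ e), T.along (T.map h) (y e) = y d} := by
    simp only [Set.ofPred_forall]
    exact isClosed_iInter fun d => isClosed_iInter fun e => isClosed_iInter fun h =>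
      isClosed_eq (continuous_of_discreteTopology.comp (continuous_apply e)) (continuous_apply d)
  convert hprod.inter_right hclosed using 1
  ext y
  constructor
  · rintro ⟨g, hg, rfl⟩
    refine ⟨fun d _ => ?_, fun d e h => g.compat h⟩
    change T.along (T.str d) (g.val d) = T.base
    rw [← smul_pt, pt_str]
    exact hg
  · rintro ⟨hy, hy'⟩
    refine ⟨⟨y, fun h => hy' _ _ h⟩, ?_, rfl⟩
    change _ • T.base = T.base
    rw [base, smul_pt]
    exact hy _ trivial

theorem isCompact_val_eq_gen (d : T.Index) : IsCompact {g : T.Deck | g.val d = T.gen d} :=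
  isCompact_smul_base.of_isClosed_subset (isClopen_val_eq d _).isClosed fun g hg => by
    change g • T.base = T.base
    rw [← pt_str d, smul_pt, show g.val d = _ from hg, T.along_gen]

theorem isLocallyProfiniteGroup : IsLocallyProfiniteGroup T.Deck where
  isTopologicalGroup := inferInstance
  t2Space := inferInstance
  locallyCompactSpace := (isCompact_val_eq_gen
    (Classical.arbitrary _)).locallyCompactSpace_of_mem_nhds_of_group
      ((nhds_hasBasis (1 : T.Deck)).mem_of_mem trivial)
  hasBasis := by
    refine (nhds_hasBasis (1 : T.Deck)).to_hasBasis (fun d _ => ?_) fun K hK => ?_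
    · have h : (MulAction.stabilizer T.Deck (T.gen d) : Set T.Deck) =
          {g : T.Deck | g.val d = T.gen d} := by
        ext g
        simp [MulAction.mem_stabilizer_iff, smul_gen]
      exact ⟨MulAction.stabilizer T.Deck (T.gen d),
        h ▸ ⟨isCompact_val_eq_gen d, (isClopen_val_eq d _).isOpen⟩, h.le⟩
    · obtain ⟨d, h, h'⟩ := (nhds_hasBasis (1 : T.Deck)).mem_iff.1 (hK.2.mem_nhds K.one_mem)
      exact ⟨d, h, h'⟩

theorem isProfiniteGroup (h : Limits.IsTerminal X₀) : IsProfiniteGroup T.Deck where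
  isTopologicalGroup := inferInstance
  t2Space := inferInstance
  totallyDisconnectedSpace := inferInstance
  compactSpace := by
    refine ⟨?_⟩
    convert isCompact_smul_base (T := T)
    refine (Set.eq_univ_of_forall fun g => ?_).symm
    -- A terminal object has a single point, so the compact stabilizer is the whole group.
    obtain ⟨d, a, b, ha, hb⟩ := T.exists_pt_pt (g • T.base) T.base
    change g • T.base = T.base
    rw [← ha, ← hb, h.hom_ext a b]

end Topological


end Deck

end GaloisTower

/-! ### Construction of a Galois tower. -/

variable {C : Type u} [Category.{v} C]

/-- Any two morphisms to the source of `f` with the same composite with `f` differ by an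
endomorphism. -/
def HasTransitiveFibres {Y X : C} (f : Y ⟶ X) : Prop :=
  ∀ {Z : C} (a b : Z ⟶ Y), a ≫ f = b ≫ f → ∃ σ : Y ⟶ Y, a ≫ σ = b

theorem IsGaloisCovering.hasTransitiveFibres {Y X : C} {f : Y ⟶ X} (hf : IsGaloisCovering f) :
    HasTransitiveFibres f := by
  obtain ⟨G, _, ρ, h⟩ := hf
  intro Z a b hab
  let _ := homAction f ρ Z
  obtain ⟨g, hg⟩ := (h Z).injective b a hab.symm
  exact ⟨(ρ g).hom.left, hg⟩

theorem HasTransitiveFibres.iso_comp {Y' Y X : C} {f : Y ⟶ X} (hf : HasTransitiveFibres f)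
    (i : Y' ≅ Y) : HasTransitiveFibres (i.hom ≫ f) := by
  intro Z a b hab
  obtain ⟨σ, hσ⟩ := hf (a ≫ i.hom) (b ≫ i.hom) (by simpa using hab)
  exact ⟨i.hom ≫ σ ≫ i.inv, by rw [reassoc_of% hσ]; simp⟩

/-- A small collection of representatives of the objects over `X₀` with transitive fibres. -/
structure CoverIndex [EssentiallySmall.{v} C] (X₀ : C) : Type v where
  rep : SmallModel.{v} C
  str : (equivSmallModel C).inverse.obj rep ⟶ X₀
  transitive : HasTransitiveFibres str

namespace CoverIndex

variable [EssentiallySmall.{v} C] {X₀ : C}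

/-- The object of `C` underlying an index. -/
noncomputable abbrev obj (d : CoverIndex X₀) : C := (equivSmallModel C).inverse.obj d.rep

instance : Preorder (CoverIndex X₀) where
  le d e := ∃ g : e.obj ⟶ d.obj, g ≫ d.str = e.str
  le_refl d := ⟨𝟙 _, Category.id_comp _⟩
  le_trans := by
    rintro c d e ⟨g, hg⟩ ⟨g', hg'⟩
    exact ⟨g' ≫ g, by rw [Category.assoc, hg, hg']⟩

theorem exists_dominating
    (hgal : ∀ {Y X : C} (f : Y ⟶ X), ∃ (Z : C) (g : Z ⟶ Y), HasTransitiveFibres (g ≫ f))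
    {Z : C} (f : Z ⟶ X₀) : ∃ (e : CoverIndex X₀) (g : e.obj ⟶ Z), g ≫ f = e.str := by
  obtain ⟨W, k, hk⟩ := hgal f
  exact ⟨⟨_, _, hk.iso_comp ((equivSmallModel C).unitIso.app W).symm⟩,
    ((equivSmallModel C).unitIso.app W).inv ≫ k, Category.assoc _ _ _⟩

variable [IsEpiOre C]

theorem isDirectedOrder
    (hgal : ∀ {Y X : C} (f : Y ⟶ X), ∃ (Z : C) (g : Z ⟶ Y), HasTransitiveFibres (g ≫ f)) :
    IsDirectedOrder (CoverIndex X₀) where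
  directed d e := by
    obtain ⟨Z, p, q, w⟩ := IsEpiOre.ore d.str e.str
    obtain ⟨c, g, hg⟩ := exists_dominating hgal (p ≫ d.str)
    exact ⟨c, ⟨g ≫ p, by simpa using hg⟩, ⟨g ≫ q, by rw [Category.assoc, ← w, hg]⟩⟩

/-- Transition maps over `X₀` can be chosen coherently. -/
theorem exists_coherent [Nonempty (CoverIndex X₀)] [IsDirectedOrder (CoverIndex X₀)]
    [∀ X Y : C, Finite (X ⟶ Y)] :
    ∃ p : ∀ {d e : CoverIndex X₀}, d ≤ e → (e.obj ⟶ d.obj),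
      (∀ {d e : CoverIndex X₀} (h : d ≤ e), p h ≫ d.str = e.str) ∧
      ∀ {c d e : CoverIndex X₀} (h : c ≤ d) (h' : d ≤ e), p h' ≫ p h = p (h.trans h') := by
  -- These choices need not be coherent. For each late `c`, some `p` carries `q e c` to `q d c`; as
  -- `e.obj ⟶ d.obj` is finite, the ultrafilter fixes one `p` valid for almost all `c`. Such
  -- equations compose, and the epimorphism `q e c` cancels.
  choose q hq using fun (d e : CoverIndex X₀) (h : d ≤ e) => h
  let U : Ultrafilter (CoverIndex X₀) := Ultrafilter.of atTop
  have hU : ∀ d : CoverIndex X₀, ∀ᶠ e in (U : Filter (CoverIndex X₀)), d ≤ e := fun d =>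
    (Ultrafilter.of_le atTop) (eventually_ge_atTop d)
  have key : ∀ (d e : CoverIndex X₀), d ≤ e → ∃ p : e.obj ⟶ d.obj,
      ∀ᶠ c in (U : Filter (CoverIndex X₀)), ∃ (h : d ≤ c) (h' : e ≤ c),
        q e c h' ≫ p = q d c h := fun d e hde => by
    rw [← Ultrafilter.eventually_exists_iff]
    filter_upwards [hU e] with c hc
    obtain ⟨σ, hσ⟩ := d.transitive (q e c hc ≫ q d e hde) (q d c (hde.trans hc))
      (by rw [Category.assoc, hq, hq, hq])
    exact ⟨q d e hde ≫ σ, hde.trans hc, hc, by rw [← Category.assoc, hσ]⟩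
  choose p hp using key
  refine ⟨fun {d e} h => p d e h, fun {d e} h => ?_, fun {c d e} h h' => ?_⟩
  · obtain ⟨c, h₁, h₂, e₁⟩ := (hp d e h).exists
    rw [← cancel_epi (q e c h₂), ← Category.assoc, e₁, hq, hq]
  · obtain ⟨b, ⟨h₁, h₂, e₁⟩, ⟨h₃, h₄, e₂⟩, ⟨h₅, h₆, e₃⟩⟩ :=
      ((hp c d h).and ((hp d e h').and (hp c e (h.trans h')))).exists
    rw [← cancel_epi (q e b h₄), ← Category.assoc, e₂, e₁, e₃]

end CoverIndex

theorem exists_galoisTower [EssentiallySmall.{v} C] [IsEpiOre C] [∀ X Y : C, Finite (X ⟶ Y)]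
    (hgal : ∀ {Y X : C} (f : Y ⟶ X), ∃ (Z : C) (g : Z ⟶ Y), HasTransitiveFibres (g ≫ f))
    (X₀ : C) : Nonempty (GaloisTower X₀) := by
  have hne : Nonempty (CoverIndex X₀) := ⟨(CoverIndex.exists_dominating hgal (𝟙 X₀)).choose⟩
  have hdir : IsDirectedOrder (CoverIndex X₀) := CoverIndex.isDirectedOrder hgal
  obtain ⟨p, hp, hp'⟩ := CoverIndex.exists_coherent (X₀ := X₀)
  refine ⟨{
    Index := CoverIndex X₀
    obj := CoverIndex.obj
    map := p
    map_refl := fun d => ?_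
    map_comp := hp'
    str := CoverIndex.str
    map_str := hp
    galois := fun d Z a b => d.transitive a b
    lift := fun d Z f => ?_ }⟩
  -- An idempotent epimorphism is the identity.
  · rw [← cancel_epi (p (le_refl d)), hp', Category.comp_id]
  · obtain ⟨e, g, hg⟩ := CoverIndex.exists_dominating hgal (f ≫ d.str)
    have h : d ≤ e := ⟨g ≫ f, by rw [Category.assoc, hg]⟩
    -- `g ≫ f` and the chosen transition map agree only over `X₀`; an endomorphism `τ` of `e.obj`
    -- corrects the difference.
    obtain ⟨W, u₁, u₂, w⟩ := IsEpiOre.ore (g ≫ f) (p h)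
    obtain ⟨τ, rfl⟩ := e.transitive u₂ u₁ (by
      have := congrArg (· ≫ d.str) w
      simp only [Category.assoc, hp, hg] at this
      exact this.symm)
    refine ⟨e, h, τ ≫ g, ?_⟩
    rw [← cancel_epi u₂, Category.assoc, ← w, Category.assoc]

/-! ### Descent along a single morphism in the atomic topology. -/

theorem IsAtomicTopology.mem_of_arrow {J : GrothendieckTopology C} (hJ : IsAtomicTopology J)
    {X Y : C} {R : Sieve X} (f : Y ⟶ X) (hf : R f) : R ∈ J X := by
  obtain ⟨hro, rfl⟩ := hJ
  exact ⟨Y, f, hf⟩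

theorem IsAtomicTopology.exists_arrow {J : GrothendieckTopology C} (hJ : IsAtomicTopology J)
    {X : C} {R : Sieve X} (hR : R ∈ J X) : ∃ (Y : C) (f : Y ⟶ X), R f := by
  obtain ⟨hro, rfl⟩ := hJ
  exact hR

theorem IsAtomicTopology.coveringMorphisms {J : GrothendieckTopology C} (hJ : IsAtomicTopology J)
    {X Y : C} (f : Y ⟶ X) : coveringMorphisms J f :=
  hJ.mem_of_arrow f ⟨_, 𝟙 _, f, Presieve.singleton_self f, Category.id_comp f⟩

theorem IsAtomicTopology.isSheafFor_singleton {J : GrothendieckTopology C}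
    (hJ : IsAtomicTopology J) (F : Sheaf J (Type v)) {X Y : C} (f : Y ⟶ X) :
    Presieve.IsSheafFor F.obj (Presieve.singleton f) := by
  rw [Presieve.isSheafFor_iff_generate]
  exact (isSheaf_iff_isSheaf_of_type J F.obj).1 F.property _ (hJ.coveringMorphisms f)

theorem IsAtomicTopology.map_injective {J : GrothendieckTopology C} (hJ : IsAtomicTopology J)
    (F : Sheaf J (Type v)) {X Y : C} (f : Y ⟶ X) : Function.Injective (F.obj.map f.op) :=
  fun s t h => (hJ.isSheafFor_singleton F f).isSeparatedFor.ext fun _ _ hf => by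
    cases hf
    exact h

theorem IsAtomicTopology.exists_map_eq {J : GrothendieckTopology C} (hJ : IsAtomicTopology J)
    (F : Sheaf J (Type v)) {X Y : C} (f : Y ⟶ X) (s : F.obj.obj (op Y))
    (hs : ∀ {Z : C} (a b : Z ⟶ Y), a ≫ f = b ≫ f → F.obj.map a.op s = F.obj.map b.op s) :
    ∃ t, F.obj.map f.op t = s := by
  obtain ⟨t, ht, -⟩ := Presieve.isSheafFor_singleton.1 (hJ.isSheafFor_singleton F f) s
    fun a b => hs a b
  exact ⟨t, ht⟩

/-! ### The stalk functor is fully faithful. -/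

namespace GaloisTower

variable {X₀ : C} (T : GaloisTower X₀) [IsEpiOre C] [∀ X Y : C, Finite (X ⟶ Y)]

/-- The stalk of a presheaf as a `T.Deck`-set. -/
noncomputable def stalkAction (F : Cᵒᵖ ⥤ Type v) : Action (Type v) T.Deck where
  V := T.Stalk F
  ρ :=
    { toFun g := ↾fun t => g • t
      map_one' := ConcreteCategory.hom_ext _ _ fun t => one_smul T.Deck t
      map_mul' g k := ConcreteCategory.hom_ext _ _ fun t => mul_smul g k t }

theorem isContinuousDiscrete_stalkAction (F : Cᵒᵖ ⥤ Type v) :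
    IsContinuousDiscrete T.Deck (T.stalkAction F) := by
  let _ : TopologicalSpace (T.Stalk F) := ⊥
  have _ : DiscreteTopology (T.Stalk F) := ⟨rfl⟩
  change Continuous fun p : T.Deck × T.Stalk F => p.1 • p.2
  rw [continuous_iff_continuousAt]
  rintro ⟨g, t⟩
  rw [ContinuousAt, nhds_prod_eq, nhds_discrete (T.Stalk F), tendsto_pure]
  filter_upwards [(Deck.eventually_smul_eq g t).prod_mk (show ∀ᶠ x in pure t, x = t from rfl)]
    with p hp
  rw [hp.2, hp.1]

/-- The stalk functor from sheaves to continuous discrete `T.Deck`-sets. -/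
noncomputable def stalkFunctor (J : GrothendieckTopology C) :
    Sheaf J (Type v) ⥤ DiscreteGSet.{v} T.Deck where
  obj F := ⟨T.stalkAction F.obj, T.isContinuousDiscrete_stalkAction F.obj⟩
  map {F F'} α := ObjectProperty.homMk
    { hom := ↾T.stalkMap α.hom
      comm := fun g => by ext t; exact (Deck.smul_stalkMap g α.hom t).symm }
  map_id F := by
    ext t
    obtain ⟨d, s, rfl⟩ := T.exists_germ t
    rfl
  map_comp α β := by
    ext t
    obtain ⟨d, s, rfl⟩ := T.exists_germ t
    rfl

section

variable {T} {J : GrothendieckTopology C} (hJ : IsAtomicTopology J)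
include hJ

theorem stalkFunctor_faithful : (T.stalkFunctor J).Faithful where
  map_injective {F F'} α β h := by
    ext X s
    obtain ⟨x⟩ : Nonempty (T.Point X.unop) := inferInstance
    refine T.pull_injective (hJ.map_injective F') x ?_
    refine (T.stalkMap_pull α.hom x s).symm.trans (Eq.trans ?_ (T.stalkMap_pull β.hom x s))
    have h' : ((T.stalkFunctor J).map α).hom.hom = ((T.stalkFunctor J).map β).hom.hom := by rw [h]
    exact ConcreteCategory.congr_hom h' (T.pull x s)

/-- An element of the stalk fixed by the stabilizer of a point of `X` comes from a section
over `X`. -/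
theorem exists_pull_eq (F : Sheaf J (Type v)) {X : C} (x : T.Point X) (t : T.Stalk F.obj)
    (ht : ∀ g : T.Deck, g • x = x → g • t = t) : ∃ s, T.pull x s = t := by
  obtain ⟨d, a, rfl⟩ := T.exists_pt x
  obtain ⟨e, h, s, rfl⟩ := T.exists_germ_ge d t
  rw [← T.pt_map h] at ht ⊢
  -- Compatibility is tested at a point `z` of `Z`: its images under `b` and `c` are `k • T.gen e`
  -- and `k' • T.gen e`, and `k'⁻¹ * k` fixes the given point of `X`, hence the germ.
  obtain ⟨s', hs'⟩ := hJ.exists_map_eq F (T.map h ≫ a) s fun {Z} b c hbc => by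
    obtain ⟨z⟩ : Nonempty (T.Point Z) := inferInstance
    refine T.pull_injective (hJ.map_injective F) z ?_
    rw [← T.pull_along, ← T.pull_along]
    obtain ⟨k, hk⟩ := Deck.exists_smul_eq (T.gen e) (T.along b z)
    obtain ⟨k', hk'⟩ := Deck.exists_smul_eq (T.gen e) (T.along c z)
    rw [← hk, ← hk', ← Deck.smul_pull, ← Deck.smul_pull, T.pull_gen, ← inv_smul_eq_iff,
      ← mul_smul, ht]
    rw [mul_smul, inv_smul_eq_iff, ← T.along_gen, Deck.smul_along, Deck.smul_along, hk, hk',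
      T.along_along, T.along_along, hbc]
  exact ⟨s', by rw [T.pull_pt, hs']⟩

/-- Equivariance makes `f (T.pull x s)` fixed by the stabilizer of `x`, so it comes from a section;
transitivity makes that section serve all points. -/
theorem stalkFunctor_full : (T.stalkFunctor J).Full where
  map_surjective {F F'} φ := by
    let f : T.Stalk F.obj → T.Stalk F'.obj := φ.hom.hom
    have hf : ∀ (g : T.Deck) t, f (g • t) = g • f t := fun g t =>
      ConcreteCategory.congr_hom (φ.hom.comm g) t
    have hex : ∀ (X : C) (s : F.obj.obj (op X)), ∃ s' : F'.obj.obj (op X),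
        ∀ x : T.Point X, T.pull x s' = f (T.pull x s) := fun X s => by
      obtain ⟨x⟩ : Nonempty (T.Point X) := inferInstance
      obtain ⟨s', hs'⟩ := exists_pull_eq hJ F' x (f (T.pull x s)) fun g hg => by
        rw [← hf, Deck.smul_pull, hg]
      refine ⟨s', fun y => ?_⟩
      obtain ⟨g, rfl⟩ := Deck.exists_smul_eq x y
      rw [← Deck.smul_pull, hs', ← hf, Deck.smul_pull]
    choose α hα using hex
    refine ⟨ObjectProperty.homMk
      { app := fun X => ↾α X.unop
        naturality := fun X Y p => ?_ }, ?_⟩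
    · ext s
      obtain ⟨y⟩ : Nonempty (T.Point Y.unop) := inferInstance
      refine T.pull_injective (hJ.map_injective F') y ?_
      change T.pull y (α Y.unop (F.obj.map p s)) = T.pull y (F'.obj.map p.unop.op (α X.unop s))
      rw [hα, ← T.pull_along, hα, T.pull_along]
      rfl
    · ext t
      obtain ⟨d, s, rfl⟩ := T.exists_germ t
      change T.germ d (α _ s) = f (T.germ d s)
      rw [← T.pull_gen, hα, T.pull_gen]

end

/-! ### The sheaf attached to a continuous discrete set. -/

section HomSheaf

variable (S : Action (Type v) T.Deck)

/-- The presheaf of equivariant maps from points to a `T.Deck`-set. -/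
noncomputable def homPresheaf : Cᵒᵖ ⥤ Type v where
  obj X := {φ : T.Point X.unop → S.V // ∀ (g : T.Deck) x, φ (g • x) = S.ρ g (φ x)}
  map f := ↾fun φ => ⟨fun y => φ.1 (T.along f.unop y), fun g y => by
    change φ.1 (T.along f.unop (g • y)) = _
    rw [← Deck.smul_along, φ.2]⟩
  map_id X := by
    refine ConcreteCategory.hom_ext _ _ fun φ => ?_
    refine Subtype.ext (funext fun y => congrArg φ.1 (?_ : T.along (𝟙 _) y = y))
    obtain ⟨d, a, rfl⟩ := T.exists_pt y
    simp
  map_comp f g := ConcreteCategory.hom_ext _ _ fun φ =>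
    Subtype.ext (funext fun y => congrArg φ.1 (T.along_along g.unop f.unop y).symm)

theorem homPresheaf_isSheaf {J : GrothendieckTopology C} (hJ : IsAtomicTopology J) :
    Presheaf.IsSheaf J (T.homPresheaf S) := by
  rw [isSheaf_iff_isSheaf_of_type]
  intro X R hR φ hφ
  obtain ⟨Y₀, f₀, hf₀⟩ := hJ.exists_arrow hR
  -- Points with equal image in `X` are represented on one member of the tower, where compatibility
  -- of the family applies. Gluing is then pointwise, through lifts along a single `f₀`.
  have hwd : ∀ {Y Y' : C} (f : Y ⟶ X) (f' : Y' ⟶ X) (hf : R f) (hf' : R f') (y : T.Point Y)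
      (y' : T.Point Y'), T.along f y = T.along f' y' → (φ f hf).1 y = (φ f' hf').1 y' := by
    intro Y Y' f f' hf hf' y y' h
    obtain ⟨d, a, a', rfl, rfl⟩ := T.exists_pt_pt y y'
    rw [T.along_pt, T.along_pt, T.pt_eq_pt_iff] at h
    have := congrArg (fun ψ => ψ.1 (T.gen d)) (hφ a a' hf hf' h)
    change (φ f hf).1 (T.along a (T.gen d)) = (φ f' hf').1 (T.along a' (T.gen d)) at this
    rwa [T.along_gen, T.along_gen] at this
  choose l hl using T.along_surjective f₀
  refine ⟨⟨fun x => (φ f₀ hf₀).1 (l x), fun g x => ?_⟩, fun Y f hf => ?_, fun ψ hψ => ?_⟩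
  · rw [← (φ f₀ hf₀).2]
    exact hwd _ _ _ _ _ _ (by rw [hl, ← Deck.smul_along, hl])
  · exact Subtype.ext (funext fun y => hwd _ _ _ _ _ _ (hl _))
  · refine Subtype.ext (funext fun x => ?_)
    change ψ.1 x = (φ f₀ hf₀).1 (l x)
    rw [← hψ f₀ hf₀]
    exact congrArg ψ.1 (hl x).symm

/-- Evaluation of germs of equivariant maps at the tautological points. -/
noncomputable def evalGen : T.Stalk (T.homPresheaf S) → S.V :=
  Quotient.lift (s := T.germSetoid (T.homPresheaf S)) (fun φ => φ.2.1 (T.gen φ.1)) (by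
    rintro ⟨d, φ⟩ ⟨e, ψ⟩ ⟨c, h, h', w⟩
    have := congrArg (fun χ => χ.1 (T.gen c)) w
    change φ.1 (T.along (T.map h) (T.gen c)) = ψ.1 (T.along (T.map h') (T.gen c)) at this
    rwa [T.along_map_gen, T.along_map_gen] at this)

theorem evalGen_pull {X : C} (x : T.Point X) (φ : (T.homPresheaf S).obj (op X)) :
    T.evalGen S (T.pull x φ) = φ.1 x := by
  obtain ⟨d, a, rfl⟩ := T.exists_pt x
  rw [T.pull_pt, ← T.along_gen]
  rfl

theorem evalGen_smul (g : T.Deck) (t : T.Stalk (T.homPresheaf S)) :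
    T.evalGen S (g • t) = S.ρ g (T.evalGen S t) := by
  obtain ⟨d, φ, rfl⟩ := T.exists_germ t
  rw [← T.pull_gen, Deck.smul_pull, evalGen_pull, evalGen_pull, φ.2]

/-- By transitivity, an equivariant map on points is determined by its value at `T.gen e`. -/
theorem evalGen_injective : Function.Injective (T.evalGen S) := by
  intro t t' h
  obtain ⟨d, φ, rfl⟩ := T.exists_germ t
  obtain ⟨e, hde, ψ, rfl⟩ := T.exists_germ_ge d t'
  rw [← T.germ_map hde] at h ⊢
  generalize (T.homPresheaf S).map (T.map hde).op φ = χ at h ⊢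
  rw [← T.pull_gen, ← T.pull_gen, evalGen_pull, evalGen_pull] at h
  refine congrArg _ (Subtype.ext (funext fun y => ?_))
  obtain ⟨g, rfl⟩ := Deck.exists_smul_eq (T.gen e) y
  rw [ψ.2, ← h, χ.2]

theorem evalGen_surjective (hS : IsContinuousDiscrete T.Deck S) :
    Function.Surjective (T.evalGen S) := by
  intro s
  have hs : ∀ᶠ g in 𝓝 (1 : T.Deck), S.ρ g s = s := by
    let _ : TopologicalSpace S.V := ⊥
    have _ : DiscreteTopology S.V := ⟨rfl⟩
    have hc : Continuous fun g : T.Deck => S.ρ g s :=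
      Continuous.comp (g := fun p : T.Deck × S.V => S.ρ p.1 p.2) hS (Continuous.prodMk_left s)
    have h1 := hc.tendsto 1
    rw [nhds_discrete S.V, tendsto_pure] at h1
    simpa using h1
  -- Continuity gives a stage `d` such that the stabilizer of `T.gen d` fixes `s`; then `g • T.gen d
  -- ↦ S.ρ g s` is well defined.
  obtain ⟨d, -, hd⟩ := (Deck.nhds_hasBasis (1 : T.Deck)).mem_iff.1 hs
  have hfix : ∀ g k : T.Deck, g • T.gen d = k • T.gen d → S.ρ g s = S.ρ k s := fun g k h => by
    have : S.ρ (k⁻¹ * g) s = s := hd (by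
      change (k⁻¹ * g).val d = T.gen d
      rw [← Deck.smul_gen, mul_smul, h, inv_smul_smul])
    have h2 : S.ρ (k * (k⁻¹ * g)) s = S.ρ k (S.ρ (k⁻¹ * g) s) := by rw [map_mul]; rfl
    rwa [mul_inv_cancel_left, this] at h2
  choose l hl using fun y => Deck.exists_smul_eq (T.gen d) y
  have hmul : ∀ (g k : T.Deck), S.ρ (g * k) s = S.ρ g (S.ρ k s) := fun g k => by
    rw [map_mul]; rfl
  refine ⟨T.germ d ⟨fun y => S.ρ (l y) s, fun g y => ?_⟩, ?_⟩
  · rw [← hmul]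
    exact hfix _ _ (by rw [hl, mul_smul, hl])
  · change S.ρ (l (T.gen d)) s = s
    rw [hfix _ 1 (by rw [hl, one_smul]), map_one]
    rfl

end HomSheaf

theorem stalkFunctor_essSurj {J : GrothendieckTopology C} (hJ : IsAtomicTopology J) :
    (T.stalkFunctor J).EssSurj where
  mem_essImage S := by
    let e := Equiv.ofBijective _
      ⟨T.evalGen_injective S.obj, T.evalGen_surjective S.obj S.property⟩
    exact ⟨⟨T.homPresheaf S.obj, T.homPresheaf_isSheaf S.obj hJ⟩,
      ⟨ObjectProperty.isoMk _ (Action.mkIso e.toIso fun g => by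
        ext t
        exact T.evalGen_smul S.obj g t)⟩⟩

theorem stalkFunctor_isEquivalence {J : GrothendieckTopology C} (hJ : IsAtomicTopology J) :
    (T.stalkFunctor J).IsEquivalence where
  faithful := stalkFunctor_faithful hJ
  full := stalkFunctor_full hJ
  essSurj := T.stalkFunctor_essSurj hJ

end GaloisTower

theorem IsYSite.isEpiOre {J : GrothendieckTopology C} (hY : IsYSite J) (hJ : IsAtomicTopology J) :
    IsEpiOre C where
  epi := hY.epi
  ore f₁ f₂ := by
    obtain ⟨hro, -⟩ := hJ
    obtain ⟨Z, g₁, g₂, h⟩ := hro f₁ f₂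
    exact ⟨Z, g₁, g₂, h⟩
  span X Y := by
    obtain ⟨Z, f, g, -, -⟩ := hY.lambdaConnected X Y
    exact ⟨Z, ⟨f⟩, ⟨g⟩⟩

theorem IsYSite.exists_hasTransitiveFibres {J : GrothendieckTopology C} (hY : IsYSite J)
    (hJ : IsAtomicTopology J) {Y X : C} (f : Y ⟶ X) :
    ∃ (Z : C) (g : Z ⟶ Y), HasTransitiveFibres (g ≫ f) := by
  have h : saturation (coveringMorphisms J) f := ⟨Y, 𝟙 Y, hJ.coveringMorphisms _⟩
  rw [← hY.enoughGalois] at h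
  obtain ⟨Z, g, hg⟩ := h
  exact ⟨Z, g, hg.hasTransitiveFibres⟩

end YSites

theorem theorem9p1 {C : Type u} [Category.{v} C] [Nonempty C] (J : GrothendieckTopology C)
    (hY : YSites.IsYSite J) (hJ : YSites.IsAtomicTopology J)
    (hfin : ∀ X Y : C, Finite (X ⟶ Y)) :
    ∃ (G : Type v) (_ : Group G) (_ : TopologicalSpace G),
      YSites.IsLocallyProfiniteGroup G ∧
      Nonempty (Sheaf J (Type v) ≌ YSites.DiscreteGSet.{v} G) ∧
      (Limits.HasTerminal C → YSites.IsProfiniteGroup G) := by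
  have := hY.isEpiOre hJ
  have := hY.essentiallySmall
  -- One base object must serve both claims, so it is taken terminal whenever possible.
  have hX : ∃ X₀ : C, Limits.HasTerminal C → Nonempty (Limits.IsTerminal X₀) := by
    by_cases h : Limits.HasTerminal C
    · exact ⟨⊤_ C, fun _ => ⟨Limits.terminalIsTerminal⟩⟩
    · exact ⟨Classical.arbitrary C, fun h' => absurd h' h⟩
  obtain ⟨X₀, hX₀⟩ := hX
  obtain ⟨T⟩ := YSites.exists_galoisTower (hY.exists_hasTransitiveFibres hJ) X₀
  have := T.stalkFunctor_isEquivalence hJ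
  exact ⟨T.Deck, inferInstance, inferInstance, YSites.GaloisTower.Deck.isLocallyProfiniteGroup,
    ⟨(T.stalkFunctor J).asEquivalence⟩,
    fun h => YSites.GaloisTower.Deck.isProfiniteGroup (hX₀ h).some⟩
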